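/- Let $V$ be a $3$-dimensional complex vector space with a hermitian form $\langle-,-\rangle$ of signature $++-$ (linear in the first argument), and let $\mathbb B=\{p\in\mathbb P_{\mathbb C}V\mid\langle p,p\rangle<0\}$. A *family of bisectors* is an $\mathbb R$-linear subspace $W\subset\mathrm{Lin}_{\mathbb C}(V,V)$ such that $\mathrm{tr}\,h=0$ and $h^*=h$ for all $h\in W$, there is a point $p\in\mathbb B$ with $\langle hp,p\rangle=0$ for all $h\in W$, and $W$ is the $\mathbb R$-span of $D_W:=\{h\in W\mid\det h=0\}$. Let $E_W\subset\mathbb P_{\mathbb R}W$ be the image of $D_W\setminus\{0\}$. Every $0\ne h\in D_W$ has rank $2$; its *focus* is the point $\mathbb P_{\mathbb C}\ker h$. The family is *elliptic* if $D_W\ne W$ and $\dim_{\mathbb R}W=3$. An elliptic family is *generic* if $E_W$ contains no confocal line (a real projective line $\mathbb P_{\mathbb R}U\subset E_W$, $\dim_{\mathbb R}U=2$, with $Uf_0=0$ for some $0\ne f_0\in V$) and $E_W$ is not the union of a real projective line and a point outside it. For a generic $W$, the *focal cubic* $E\subset\mathbb P_{\mathbb C}V$ is the set of the points $\mathbb P_{\mathbb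 C}\ker h$, where $0\ne h$ runs over the elements of the complex span $\mathbb CW$ with $\det h=0$. A generic elliptic family $W$ is *real* if there are $3$ distinct points in $E_W$ whose foci lie on a same complex projective line that is not included in $E$. A family $W$ is *equitant* if there are $\sigma\in\{1,0,-1\}$ and $p_1,p_2,p_3,p_4\in V$ with $\langle p_i,p_i\rangle=\sigma$ for all $i$, representing points of $\mathbb P_{\mathbb C}V$ no $3$ of which are on a same complex projective line, such that $|\langle q,p_i\rangle|=1$ for all $i$ for some $q\in V$ with $\langle q,q\rangle<0$, and $$W=\Big\{\sum_{i=1}^4r_i\langle-,p_i\rangle p_i\ \Big|\ r_i\in\mathbb R,\ \sum_{i=1}^4r_i=0\Big\}.$$ **Proposition.** An elliptic family of bisectors $W$ is equitant if and only if it is real. -/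

import Mathlib

namespace BisectorFamily

variable {V : Type*} [AddCommGroup V] [Module ℂ V]

/-- A form `⟨x, y⟩`, linear in `x` and conjugate-linear in `y`, is hermitian of signature `++-` on a
three-dimensional space: some basis of `V` is orthogonal with squares `1, 1, -1`. -/
def IsHermitianPPM (form : V →ₗ[ℂ] V →ₗ⋆[ℂ] ℂ) : Prop :=
  ∃ b : Module.Basis (Fin 3) ℂ V, ∀ i j, form (b i) (b j) = Matrix.diagonal ![1, 1, -1] i j

/-- `p` represents a point of the ball `𝔹`; `⟨p, p⟩` is real since the form is hermitian. -/
def IsNegative (form : V →ₗ[ℂ] V →ₗ⋆[ℂ] ℂ) (p : V) : Prop :=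
  (form p p).re < 0

/-- `D_W`, the maps `h ∈ W` with `det h = 0`. Its nonzero elements, up to real factors, are the
points of the real projective curve `E_W`. -/
def degenerate (W : Submodule ℝ (V →ₗ[ℂ] V)) : Set (V →ₗ[ℂ] V) :=
  {h | h ∈ W ∧ LinearMap.det h = 0}

/-- A family of bisectors: a real subspace `W` of traceless self-adjoint maps, spanned by `D_W`,
whose base meets the ball. -/
structure IsFamily (form : V →ₗ[ℂ] V →ₗ⋆[ℂ] ℂ) (W : Submodule ℝ (V →ₗ[ℂ] V)) : Prop where
  trace_eq_zero : ∀ h ∈ W, LinearMap.trace ℂ V h = 0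
  selfAdjoint : ∀ h ∈ W, ∀ x y : V, form (h x) y = form x (h y)
  base_meets_ball : ∃ p : V, IsNegative form p ∧ ∀ h ∈ W, form (h p) p = 0
  span_degenerate : Submodule.span ℝ (degenerate W) = W

/-- An elliptic family of bisectors. -/
structure IsElliptic (form : V →ₗ[ℂ] V →ₗ⋆[ℂ] ℂ) (W : Submodule ℝ (V →ₗ[ℂ] V)) : Prop
    extends IsFamily form W where
  degenerate_ne : degenerate W ≠ (W : Set (V →ₗ[ℂ] V))
  finrank_eq : Module.finrank ℝ W = 3

/-- `E_W` contains a confocal line: a real projective line `ℙU ⊆ E_W` all of whose members kill a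
common nonzero vector. -/
def ContainsConfocalLine (W : Submodule ℝ (V →ₗ[ℂ] V)) : Prop :=
  ∃ U : Submodule ℝ (V →ₗ[ℂ] V), Module.finrank ℝ U = 2 ∧
    (U : Set (V →ₗ[ℂ] V)) ⊆ degenerate W ∧ ∃ v : V, v ≠ 0 ∧ ∀ h ∈ U, h v = 0

/-- `E_W` is a real projective line `ℙU` plus a point `[h₀]` outside it. -/
def IsLinePlusPoint (W : Submodule ℝ (V →ₗ[ℂ] V)) : Prop :=
  ∃ (U : Submodule ℝ (V →ₗ[ℂ] V)) (h₀ : V →ₗ[ℂ] V), Module.finrank ℝ U = 2 ∧ h₀ ∉ U ∧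
    degenerate W = (U : Set (V →ₗ[ℂ] V)) ∪ (Submodule.span ℝ {h₀} : Set (V →ₗ[ℂ] V))

/-- A generic elliptic family of bisectors. -/
structure IsGeneric (form : V →ₗ[ℂ] V →ₗ⋆[ℂ] ℂ) (W : Submodule ℝ (V →ₗ[ℂ] V)) : Prop
    extends IsElliptic form W where
  no_confocal_line : ¬ ContainsConfocalLine W
  not_line_plus_point : ¬ IsLinePlusPoint W

/-- The nonzero vectors representing the points of the focal cubic `E ⊆ ℙ_ℂ V`: the kernels of the
points of the complex cubic `det = 0` in `ℙ_ℂ(ℂW)`. -/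
def focalCubic (W : Submodule ℝ (V →ₗ[ℂ] V)) : Set V :=
  {v | v ≠ 0 ∧ ∃ h ∈ Submodule.span ℂ (W : Set (V →ₗ[ℂ] V)),
    h ≠ 0 ∧ LinearMap.det h = 0 ∧ h v = 0}

/-- A real family of bisectors: `W` is a generic elliptic family, and three distinct points
`[h 0], [h 1], [h 2]` of `E_W` have their foci `ℙ (ker (h i))` on a complex projective line `ℙL`
that is not included in the focal cubic. -/
structure IsReal (form : V →ₗ[ℂ] V →ₗ⋆[ℂ] ℂ) (W : Submodule ℝ (V →ₗ[ℂ] V)) : Prop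
    extends IsGeneric form W where
  exists_collinear_foci : ∃ (h : Fin 3 → (V →ₗ[ℂ] V)) (L : Submodule ℂ V),
    (∀ i, h i ∈ degenerate W ∧ h i ≠ 0) ∧
    (∀ i j, i ≠ j → ∀ t : ℝ, h i ≠ t • h j) ∧
    Module.finrank ℂ L = 2 ∧
    (∀ i, LinearMap.ker (h i) ≤ L) ∧
    ∃ v ∈ L, v ≠ 0 ∧ v ∉ focalCubic W

/-- The map `⟨-, p⟩ p`. -/
def rankOne (form : V →ₗ[ℂ] V →ₗ⋆[ℂ] ℂ) (p : V) : V →ₗ[ℂ] V :=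
  (form.flip p).smulRight p

/-- `W` is equitant from four points of a same signature `σ`, no three of which are on a complex
projective line. The points are given by representatives `p i` with `⟨p i, p i⟩ = σ` and
`|⟨q, p i⟩| = 1` for a negative `q`. -/
def IsEquitant (form : V →ₗ[ℂ] V →ₗ⋆[ℂ] ℂ) (W : Submodule ℝ (V →ₗ[ℂ] V)) : Prop :=
  ∃ (σ : ℝ) (p : Fin 4 → V),
    (σ = 1 ∨ σ = 0 ∨ σ = -1) ∧
    (∀ i, form (p i) (p i) = (σ : ℂ)) ∧
    (∀ e : Fin 3 → Fin 4, Function.Injective e → LinearIndependent ℂ (p ∘ e)) ∧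
    (∃ q : V, IsNegative form q ∧ ∀ i, ‖form q (p i)‖ = 1) ∧
    ∀ h : V →ₗ[ℂ] V, h ∈ W ↔
      ∃ r : Fin 4 → ℝ, ∑ i, r i = 0 ∧ h = ∑ i, r i • rankOne form (p i)

end BisectorFamily

namespace BisectorFamily

variable {V : Type*} [AddCommGroup V] [Module ℂ V] {form : V →ₗ[ℂ] V →ₗ⋆[ℂ] ℂ}

open ComplexConjugate

/-! Write R_p = ⟨-, p⟩p. The difference R_a - R_b is degenerate: it kills the vectors orthogonal to
a and b. Both directions rest on this.

If W is equitant from p_0, ..., p_3, the foci of R_{p_0} - R_{p_i}, i = 1, 2, 3, lie on the line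
p_0^⊥. A point v of that line orthogonal to no other p_i is outside the focal cubic: Σ r_i⟨v,
p_i⟩p_i = 0 forces r_i = 0 for i ≠ 0, and then r_0 = 0 because Σ r_i = 0. Genericity follows from
general position in the same manner.

Conversely, let the three foci lie on p^⊥ and let v ∈ p^⊥ be outside the cubic, so that evaluation
at v is injective on ℂW. If ⟨hv, v⟩ ≠ 0 for one of the three maps h, then h = sR_p + tR_{hv}
(`exists_eq_rankOne_add`). Tracelessness and the base point in the ball force st < 0, so R_p - R_u ∈
W for a multiple u of hv. When this applies to all three maps, p and the three vectors u are the
required points (`generalPosition_of_foci`). Otherwise exactly one map is hyperbolic, ⟨-, w⟩p + ⟨-,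
p⟩w, the other two give a and b, and four points are written explicitly in the basis p, a, b
(`IsElliptic.isEquitant_of_hyperbolic_pos`). In both cases dim W = 3 and the conditions on W supply
the rest (`IsElliptic.isEquitant_of_generalPosition`). -/

@[simp]
lemma rankOne_apply (p x : V) : rankOne form p x = form x p • p := rfl

/-! ### Linear algebra of a hermitian form of signature ++- -/

lemma IsHermitianPPM.exists_coordinates (hform : IsHermitianPPM form) :
    ∃ b : Module.Basis (Fin 3) ℂ V, ∀ x y, form x y =
      b.repr x 0 * conj (b.repr y 0) + b.repr x 1 * conj (b.repr y 1) -
        b.repr x 2 * conj (b.repr y 2) := by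
  obtain ⟨b, hb⟩ := hform
  refine ⟨b, fun x y => ?_⟩
  conv_lhs => rw [← b.sum_repr x, ← b.sum_repr y]
  simp only [Fin.sum_univ_three, map_add, map_smul, map_smulₛₗ, LinearMap.add_apply,
    LinearMap.smul_apply, hb, smul_eq_mul]
  simp [Matrix.diagonal]
  ring

lemma IsHermitianPPM.finrank_eq (hform : IsHermitianPPM form) : Module.finrank ℂ V = 3 := by
  obtain ⟨b, -⟩ := hform
  simp [Module.finrank_eq_card_basis b]

lemma IsHermitianPPM.finite (hform : IsHermitianPPM form) : Module.Finite ℂ V :=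
  Module.finite_of_finrank_pos (by rw [hform.finrank_eq]; norm_num)

lemma IsHermitianPPM.conj_form (hform : IsHermitianPPM form) (x y : V) :
    conj (form x y) = form y x := by
  obtain ⟨b, hb⟩ := hform.exists_coordinates
  simp only [hb, map_add, map_sub, map_mul, Complex.conj_conj]
  ring

lemma IsHermitianPPM.form_eq_zero_symm (hform : IsHermitianPPM form) {x y : V}
    (h : form x y = 0) : form y x = 0 := by
  rw [← hform.conj_form, h, map_zero]

lemma IsHermitianPPM.form_self_eq_re (hform : IsHermitianPPM form) (x : V) :
    form x x = ((form x x).re : ℂ) :=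
  (Complex.conj_eq_iff_re.1 (hform.conj_form x x)).symm

lemma IsHermitianPPM.eq_zero_of_forall (hform : IsHermitianPPM form) {x : V}
    (h : ∀ y, form x y = 0) : x = 0 := by
  obtain ⟨b, hb⟩ := hform.exists_coordinates
  refine b.repr.map_eq_zero_iff.1 (Finsupp.ext fun i => ?_)
  have := h (b i)
  rw [hb] at this
  fin_cases i <;> simpa [Finsupp.single_apply] using this

lemma IsHermitianPPM.eq_zero_of_basis (hform : IsHermitianPPM form) {e : Fin 3 → V}
    (he : LinearIndependent ℂ e) {x : V} (h : ∀ i, form x (e i) = 0) : x = 0 := by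
  have := hform.finite
  let b := basisOfLinearIndependentOfCardEqFinrank he (by simp [hform.finrank_eq])
  refine hform.eq_zero_of_forall fun y => ?_
  rw [← b.sum_repr y, map_sum]
  exact Finset.sum_eq_zero fun i _ => by
    rw [map_smulₛₗ, coe_basisOfLinearIndependentOfCardEqFinrank, h, smul_zero]

lemma IsHermitianPPM.exists_orthogonal_pair (hform : IsHermitianPPM form) (a b : V) :
    ∃ x : V, x ≠ 0 ∧ form x a = 0 ∧ form x b = 0 := by
  have := hform.finite
  let φ : V →ₗ[ℂ] ℂ × ℂ := (form.flip a).prod (form.flip b)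
  have hφ : LinearMap.ker φ ≠ ⊥ :=
    LinearMap.ker_ne_bot_of_finrank_lt (by simp [hform.finrank_eq])
  obtain ⟨x, hx, hx0⟩ := (Submodule.ne_bot_iff _).1 hφ
  exact ⟨x, hx0, congrArg Prod.fst hx, congrArg Prod.snd hx⟩

/-- The orthogonal complement of a negative vector is positive definite. -/
lemma IsHermitianPPM.pos_of_orthogonal_negative (hform : IsHermitianPPM form) {q u : V}
    (hq : IsNegative form q) (hqu : form q u = 0) (hu : u ≠ 0) : 0 < (form u u).re := by
  obtain ⟨b, hb⟩ := hform.exists_coordinates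
  have hre : ∀ x, (form x x).re =
      ‖b.repr x 0‖ ^ 2 + ‖b.repr x 1‖ ^ 2 - ‖b.repr x 2‖ ^ 2 := by
    intro x
    rw [hb, Complex.mul_conj', Complex.mul_conj', Complex.mul_conj']
    norm_cast
  have hu' : ‖b.repr u 0‖ ^ 2 + ‖b.repr u 1‖ ^ 2 + ‖b.repr u 2‖ ^ 2 ≠ 0 := by
    intro h
    refine hu (b.repr.map_eq_zero_iff.1 (Finsupp.ext fun i => ?_))
    have h0 : ‖b.repr u 0‖ = 0 := by nlinarith [sq_nonneg ‖b.repr u 1‖, sq_nonneg ‖b.repr u 2‖]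
    have h1 : ‖b.repr u 1‖ = 0 := by nlinarith [sq_nonneg ‖b.repr u 0‖, sq_nonneg ‖b.repr u 2‖]
    have h2 : ‖b.repr u 2‖ = 0 := by nlinarith [sq_nonneg ‖b.repr u 0‖, sq_nonneg ‖b.repr u 1‖]
    fin_cases i
    exacts [norm_eq_zero.1 h0, norm_eq_zero.1 h1, norm_eq_zero.1 h2]
  have hcs : ‖b.repr q 2‖ * ‖b.repr u 2‖ ≤
      ‖b.repr q 0‖ * ‖b.repr u 0‖ + ‖b.repr q 1‖ * ‖b.repr u 1‖ := by
    have h := hb q u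
    rw [hqu] at h
    have h2 : b.repr q 2 * conj (b.repr u 2) =
        b.repr q 0 * conj (b.repr u 0) + b.repr q 1 * conj (b.repr u 1) := by
      linear_combination h
    calc _ = ‖b.repr q 2 * conj (b.repr u 2)‖ := by simp
      _ ≤ _ := by rw [h2]; exact (norm_add_le _ _).trans (by simp)
  unfold IsNegative at hq
  rw [hre] at hq ⊢
  generalize ‖b.repr q 0‖ = q0, ‖b.repr q 1‖ = q1 at *
  have hq2 := norm_nonneg (b.repr q 2)
  have hu2 := norm_nonneg (b.repr u 2)
  generalize ‖b.repr q 2‖ = q2 at *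
  generalize ‖b.repr u 0‖ = u0, ‖b.repr u 1‖ = u1, ‖b.repr u 2‖ = u2 at *
  by_contra! hle
  have hsq : (q2 * u2) ^ 2 ≤ (q0 * u0 + q1 * u1) ^ 2 :=
    pow_le_pow_left₀ (mul_nonneg hq2 hu2) hcs 2
  have hu2' : 0 < u2 ^ 2 := by
    rcases (sq_nonneg u2).lt_or_eq with h | h
    · exact h
    · exact absurd (by nlinarith [sq_nonneg u0, sq_nonneg u1]) hu'
  -- By Cauchy–Schwarz, q2²u2² ≤ (q0² + q1²)(u0² + u1²) ≤ (q0² + q1²)u2² < q2²u2², a contradiction.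
  nlinarith [sq_nonneg (q0 * u1 - q1 * u0), mul_pos hu2' (sub_pos.2 hq),
    mul_nonneg (add_nonneg (sq_nonneg q0) (sq_nonneg q1)) (sub_nonneg.2 hle)]

lemma IsHermitianPPM.trace_rankOne (hform : IsHermitianPPM form) (p : V) :
    LinearMap.trace ℂ V (rankOne form p) = form p p := by
  have := hform.finite
  rw [rankOne, LinearMap.trace_smulRight, LinearMap.flip_apply]

lemma rankOne_smul (c : ℂ) (p : V) : rankOne form (c • p) = ((‖c‖ ^ 2 : ℝ) : ℂ) • rankOne form p := by
  ext x
  simp only [rankOne_apply, map_smulₛₗ, LinearMap.smul_apply, smul_smul, smul_eq_mul]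
  congr 1
  push_cast
  rw [← Complex.mul_conj']
  ring

lemma det_eq_zero_of_apply_eq_zero {h : V →ₗ[ℂ] V} (hform : IsHermitianPPM form) {v : V}
    (hv : v ≠ 0) (hhv : h v = 0) : LinearMap.det h = 0 := by
  have := hform.finite
  exact LinearMap.det_eq_zero_iff_ker_ne_bot.2 ((Submodule.ne_bot_iff _).2 ⟨v, hhv, hv⟩)

/-! ### Four vectors in general position -/

/-- Four vectors, any three of which are linearly independent. -/
def GeneralPosition (p : Fin 4 → V) : Prop :=
  ∀ e : Fin 3 → Fin 4, Function.Injective e → LinearIndependent ℂ (p ∘ e)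

lemma exists_complementary_indices (i : Fin 4) :
    ∃ j k l : Fin 4, i ≠ j ∧ i ≠ k ∧ i ≠ l ∧ j ≠ k ∧ j ≠ l ∧ k ≠ l ∧
      ∀ m, m = i ∨ m = j ∨ m = k ∨ m = l := by
  revert i; decide

lemma GeneralPosition.smul {p : Fin 4 → V} (hp : GeneralPosition p) {c : ℂ} (hc : c ≠ 0) :
    GeneralPosition fun i => c • p i := fun e he =>
  (hp e he).units_smul fun _ => Units.mk0 c hc

lemma GeneralPosition.coeff_eq_zero {p : Fin 4 → V} (hp : GeneralPosition p) {a : Fin 4 → ℂ}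
    {n : Fin 4} (hn : a n = 0) (h : ∑ i, a i • p i = 0) (i : Fin 4) : a i = 0 := by
  rw [Fin.sum_univ_succAbove _ n, hn, zero_smul, zero_add] at h
  have := Fintype.linearIndependent_iff.1 (hp n.succAbove n.succAbove_right_injective)
    (fun j => a (n.succAbove j)) h
  rcases eq_or_ne i n with rfl | hi
  · exact hn
  · obtain ⟨j, rfl⟩ := Fin.exists_succAbove_eq hi
    exact this j

lemma GeneralPosition.eq_zero_of_orthogonal {p : Fin 4 → V} (hp : GeneralPosition p)
    (hform : IsHermitianPPM form) (n : Fin 4) {x : V} (h : ∀ i, i ≠ n → form x (p i) = 0) :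
    x = 0 :=
  hform.eq_zero_of_basis (hp n.succAbove n.succAbove_right_injective)
    fun i => h _ (n.succAbove_ne i)

/-- Evaluation at a vector x orthogonal to two of the points leaves a relation between the other
two, which are independent and not orthogonal to x. -/
lemma GeneralPosition.rankOne_coeff_eq_zero {p : Fin 4 → V} (hp : GeneralPosition p)
    (hform : IsHermitianPPM form) {r : Fin 4 → ℂ} (h : ∑ i, r i • rankOne form (p i) = 0)
    (i : Fin 4) : r i = 0 := by
  obtain ⟨j, k, l, hij, hik, hil, hjk, hjl, hkl, hall⟩ := exists_complementary_indices i
  obtain ⟨x, hx, hxk, hxl⟩ := hform.exists_orthogonal_pair (p k) (p l)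
  have hsum : ∑ m, (r m * form x (p m)) • p m = 0 := by
    simpa [LinearMap.sum_apply, smul_smul] using congrArg (fun f : V →ₗ[ℂ] V => f x) h
  refine (mul_eq_zero.1 (hp.coeff_eq_zero (n := k) (by simp [hxk]) hsum i)).resolve_right ?_
  refine fun hxi => hx (hp.eq_zero_of_orthogonal hform j fun m hm => ?_)
  rcases hall m with rfl | rfl | rfl | rfl
  exacts [hxi, absurd rfl hm, hxk, hxl]

lemma GeneralPosition.rankOne_real_coeff_eq_zero {p : Fin 4 → V} (hp : GeneralPosition p)
    (hform : IsHermitianPPM form) {r : Fin 4 → ℝ} (h : ∑ i, r i • rankOne form (p i) = 0)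
    (i : Fin 4) : r i = 0 := by
  exact_mod_cast hp.rankOne_coeff_eq_zero hform (r := fun i => (r i : ℂ)) (by simpa using h) i

/-! ### Trace, base point and normalisation of the four points -/

lemma IsFamily.form_self_eq {W : Submodule ℝ (V →ₗ[ℂ] V)} (hW : IsFamily form W)
    (hform : IsHermitianPPM form) {s t : ℝ} {a b : V}
    (h : s • rankOne form a + t • rankOne form b ∈ W) :
    s * (form a a).re + t * (form b b).re = 0 := by
  have h1 := hW.trace_eq_zero _ h
  rw [← Complex.coe_smul, ← Complex.coe_smul, map_add, map_smul, map_smul, hform.trace_rankOne,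
    hform.trace_rankOne, hform.form_self_eq_re a, hform.form_self_eq_re b] at h1
  simp only [smul_eq_mul] at h1
  exact_mod_cast h1

lemma norm_form_sq_eq {W : Submodule ℝ (V →ₗ[ℂ] V)} (hform : IsHermitianPPM form) {s t : ℝ}
    {a b q : V} (hq : ∀ h ∈ W, form (h q) q = 0)
    (h : s • rankOne form a + t • rankOne form b ∈ W) :
    s * ‖form q a‖ ^ 2 + t * ‖form q b‖ ^ 2 = 0 := by
  have h1 := hq _ h
  simp only [LinearMap.add_apply, LinearMap.smul_apply, rankOne_apply, map_add, map_smul,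
    ← Complex.coe_smul, smul_eq_mul] at h1
  rw [← hform.conj_form q a, ← hform.conj_form q b, Complex.mul_conj', Complex.mul_conj'] at h1
  exact_mod_cast h1

/-- Four vectors in general position whose rank one maps differ by elements of `W` can be
normalised so as to show that `W` is equitant. -/
lemma IsElliptic.isEquitant_of_generalPosition {W : Submodule ℝ (V →ₗ[ℂ] V)}
    (hform : IsHermitianPPM form) (hW : IsElliptic form W) {p : Fin 4 → V}
    (hp : GeneralPosition p)
    (hpW : ∀ i : Fin 3, rankOne form (p 0) - rankOne form (p i.succ) ∈ W) :
    IsEquitant form W := by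
  obtain ⟨q, hqneg, hq⟩ := hW.base_meets_ball
  have hq0 : q ≠ 0 := by
    rintro rfl
    simp [IsNegative] at hqneg
  have hpW' : ∀ i : Fin 3,
      (1 : ℝ) • rankOne form (p 0) + (-1 : ℝ) • rankOne form (p i.succ) ∈ W := by
    intro i
    convert hpW i using 1
    module
  have hself : ∀ i, (form (p i) (p i)).re = (form (p 0) (p 0)).re := by
    refine Fin.cases rfl fun i => ?_
    linarith [hW.toIsFamily.form_self_eq hform (hpW' i)]
  have hnorm : ∀ i, ‖form q (p i)‖ = ‖form q (p 0)‖ := by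
    refine Fin.cases rfl fun i => ?_
    refine (sq_eq_sq₀ (norm_nonneg _) (norm_nonneg _)).1 ?_
    linarith [norm_form_sq_eq hform hq (hpW' i)]
  have hN : ‖form q (p 0)‖ ≠ 0 := fun h => hq0 <|
    hp.eq_zero_of_orthogonal hform 0 fun i _ => norm_eq_zero.1 ((hnorm i).trans h)
  have hli : LinearIndependent ℝ fun i : Fin 3 => rankOne form (p 0) - rankOne form (p i.succ) := by
    refine Fintype.linearIndependent_iff.2 fun g hg i => ?_
    have := hp.rankOne_real_coeff_eq_zero hform
      (r := Fin.cons (∑ i, g i) fun i => -g i) ?_ i.succ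
    · simpa using this
    · rw [← hg, Fin.sum_univ_succ]
      simp only [Fin.cons_zero, Fin.cons_succ, Fin.sum_univ_three]
      module
  -- The three differences are independent, so they span the three-dimensional W.
  have : Module.Finite ℝ W := Module.finite_of_finrank_pos (by rw [hW.finrank_eq]; norm_num)
  have hspan : Submodule.span ℝ
      (Set.range fun i : Fin 3 => rankOne form (p 0) - rankOne form (p i.succ)) = W := by
    refine Submodule.eq_of_le_of_finrank_eq (Submodule.span_le.2 ?_) ?_
    · rintro _ ⟨i, rfl⟩
      exact hpW i
    · rw [finrank_span_eq_card hli, hW.finrank_eq, Fintype.card_fin]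
  obtain ⟨l, hl, σ, hσ, hlσ⟩ : ∃ l : ℝ, 0 < l ∧ ∃ σ : ℝ, (σ = 1 ∨ σ = 0 ∨ σ = -1) ∧
      l ^ 2 * (form (p 0) (p 0)).re = σ := by
    generalize (form (p 0) (p 0)).re = s
    rcases lt_trichotomy s 0 with hs | hs | hs
    · refine ⟨(√(-s))⁻¹, by simpa using hs, -1, by simp, ?_⟩
      rw [inv_pow, Real.sq_sqrt (by linarith), inv_neg, neg_mul, inv_mul_cancel₀ hs.ne]
    · exact ⟨1, one_pos, 0, by simp, by simp [hs]⟩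
    · refine ⟨(√s)⁻¹, by simpa using hs, 1, by simp, ?_⟩
      rw [inv_pow, Real.sq_sqrt hs.le, inv_mul_cancel₀ hs.ne']
  have hlc : (l : ℂ) ≠ 0 := by exact_mod_cast hl.ne'
  have hR : ∀ i, rankOne form ((l : ℂ) • p i) = (l ^ 2) • rankOne form (p i) := by
    intro i
    rw [rankOne_smul, Complex.norm_real, Real.norm_eq_abs, sq_abs, Complex.coe_smul]
  refine ⟨σ, fun i => (l : ℂ) • p i, hσ, fun i => ?_, hp.smul hlc,
    ⟨((l * ‖form q (p 0)‖ : ℝ) : ℂ)⁻¹ • q, ?_, fun i => ?_⟩, fun h => ?_⟩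
  · rw [map_smul form, LinearMap.smul_apply, map_smulₛₗ, hform.form_self_eq_re, hself, ← hlσ]
    simp only [Complex.conj_ofReal, smul_eq_mul]
    push_cast
    ring
  · unfold IsNegative at hqneg ⊢
    rw [map_smul form, LinearMap.smul_apply, map_smulₛₗ, hform.form_self_eq_re, ← Complex.ofReal_inv,
      Complex.conj_ofReal, smul_eq_mul, smul_eq_mul, ← Complex.ofReal_mul, ← Complex.ofReal_mul,
      Complex.ofReal_re]
    have : 0 < (l * ‖form q (p 0)‖)⁻¹ :=
      inv_pos.2 (mul_pos hl ((norm_nonneg _).lt_of_ne' hN))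
    exact mul_neg_of_pos_of_neg this (mul_neg_of_pos_of_neg this hqneg)
  · rw [map_smul form, LinearMap.smul_apply, map_smulₛₗ, norm_smul, norm_smul, hnorm i]
    simp only [norm_inv, Complex.norm_real, norm_mul, Real.norm_eq_abs,
      abs_of_pos hl, abs_norm, Complex.conj_ofReal]
    field_simp
  · simp only [hR]
    rw [← hspan, Submodule.mem_span_range_iff_exists_fun]
    constructor
    · rintro ⟨c, rfl⟩
      -- The rescaled points have rank one maps multiplied by l², hence the division.
      refine ⟨![(c 0 + c 1 + c 2) / l ^ 2, -c 0 / l ^ 2, -c 1 / l ^ 2, -c 2 / l ^ 2], ?_, ?_⟩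
      · simp [Fin.sum_univ_four]
        ring
      · simp [Fin.sum_univ_four, Fin.sum_univ_three, smul_smul,
          div_mul_cancel₀ _ (pow_ne_zero 2 hl.ne')]
        module
    · rintro ⟨r, hr, rfl⟩
      refine ⟨fun i => -(r i.succ * l ^ 2), ?_⟩
      rw [Fin.sum_univ_four] at hr ⊢
      have hr0 : r 0 = -(r 1 + r 2 + r 3) := by linear_combination hr
      simp [Fin.sum_univ_three, hr0]
      module

/-! ### Equitant families are real -/

/-- The space spanned by the differences of the rank one maps of four vectors. -/
def EquitantSpan (form : V →ₗ[ℂ] V →ₗ⋆[ℂ] ℂ) (p : Fin 4 → V)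
    (W : Submodule ℝ (V →ₗ[ℂ] V)) : Prop :=
  ∀ h : V →ₗ[ℂ] V, h ∈ W ↔
    ∃ r : Fin 4 → ℝ, ∑ i, r i = 0 ∧ h = ∑ i, r i • rankOne form (p i)

lemma sub_eq_sum (f : Fin 4 → (V →ₗ[ℂ] V)) (i j : Fin 4) :
    f i - f j = ∑ m, ((Pi.single i 1 - Pi.single j 1 : Fin 4 → ℝ) m) • f m := by
  simp [sub_smul, Finset.sum_sub_distrib, Pi.single_apply]

variable {p : Fin 4 → V} {W : Submodule ℝ (V →ₗ[ℂ] V)}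

lemma EquitantSpan.sub_mem (h : EquitantSpan form p W) (i j : Fin 4) :
    rankOne form (p i) - rankOne form (p j) ∈ W :=
  (h _).2 ⟨Pi.single i 1 - Pi.single j 1, by simp [Finset.sum_sub_distrib],
    sub_eq_sum (fun i => rankOne form (p i)) i j⟩

lemma EquitantSpan.sub_mem_degenerate (hform : IsHermitianPPM form) (h : EquitantSpan form p W)
    (i j : Fin 4) : rankOne form (p i) - rankOne form (p j) ∈ degenerate W := by
  obtain ⟨x, hx, hi, hj⟩ := hform.exists_orthogonal_pair (p i) (p j)
  exact ⟨h.sub_mem i j, det_eq_zero_of_apply_eq_zero hform hx (by simp [hi, hj])⟩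

lemma GeneralPosition.eq_zero_of_smul_sub_eq (hp : GeneralPosition p)
    (hform : IsHermitianPPM form) {i j k l : Fin 4} {s t : ℝ} (hij : i ≠ j) (hik : i ≠ k)
    (hil : i ≠ l) (h : s • (rankOne form (p i) - rankOne form (p j)) =
      t • (rankOne form (p k) - rankOne form (p l))) : s = 0 := by
  rw [sub_eq_sum (fun i => rankOne form (p i)) i j, sub_eq_sum (fun i => rankOne form (p i)) k l,
    ← sub_eq_zero, Finset.smul_sum, Finset.smul_sum, ← Finset.sum_sub_distrib] at h
  simp only [smul_smul, ← sub_smul] at h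
  simpa [hij, hik, hil] using hp.rankOne_real_coeff_eq_zero hform h i

lemma GeneralPosition.rankOne_injective (hp : GeneralPosition p) (hform : IsHermitianPPM form) :
    Function.Injective fun i => rankOne form (p i) := by
  intro i j h
  by_contra hij
  exact one_ne_zero (α := ℝ) <| hp.eq_zero_of_smul_sub_eq hform (s := 1) (t := 0) hij hij hij
    (k := j) (l := j) (by simpa [sub_eq_zero] using h)

/-- All differences R_i - R_j are degenerate. If one were outside ℙU, it would be the isolated
point; in a triangle i, j, k another side would then be outside too, hence proportional to it, which
independence forbids. So U contains all the differences, hence W, whose dimension is too large. -/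
lemma EquitantSpan.not_isLinePlusPoint (hform : IsHermitianPPM form) (hp : GeneralPosition p)
    (h : EquitantSpan form p W) (hW : Module.finrank ℝ W = 3) : ¬ IsLinePlusPoint W := by
  rintro ⟨U, h₀, hU, -, hD⟩
  let R : Fin 4 → (V →ₗ[ℂ] V) := fun i => rankOne form (p i)
  have hmem : ∀ i j, R i - R j ∈ U ∨ ∃ t : ℝ, R i - R j = t • h₀ := by
    intro i j
    have := h.sub_mem_degenerate hform i j
    rw [hD] at this
    refine this.imp id fun h => ?_
    obtain ⟨t, ht⟩ := Submodule.mem_span_singleton.1 h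
    exact ⟨t, ht.symm⟩
  have hindep : ∀ i j k l (s t : ℝ), i ≠ j → i ≠ k → i ≠ l → k ≠ l →
      R i - R j = s • h₀ → R k - R l = t • h₀ → False := by
    intro i j k l s t hij hik hil hkl hs ht
    have ht0 : t = 0 := hp.eq_zero_of_smul_sub_eq hform (t := s) hij hik hil
      (show t • (R i - R j) = s • (R k - R l) by rw [hs, ht, smul_comm])
    rw [ht0, zero_smul, sub_eq_zero] at ht
    exact hkl (hp.rankOne_injective hform ht)
  have hall : ∀ i j, i ≠ j → R i - R j ∈ U := by
    intro i j hij
    by_contra hn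
    obtain ⟨s, hs⟩ := (hmem i j).resolve_left hn
    obtain ⟨k, hki, hkj⟩ : ∃ k, k ≠ i ∧ k ≠ j := by
      clear hn hs
      revert i j
      decide
    rcases hmem k j with h1 | ⟨t, ht⟩
    · rcases hmem k i with h2 | ⟨t, ht⟩
      · exact hn (by simpa using U.sub_mem h1 h2)
      · exact hindep j i k i (-s) t hij.symm hkj.symm hij.symm hki
          (by rw [neg_smul, ← hs, neg_sub]) ht
    · exact hindep i j k j s t hij hki.symm hij hkj hs ht
  have hfin : Module.Finite ℝ U := Module.finite_of_finrank_pos (by rw [hU]; norm_num)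
  have hle : W ≤ U := by
    intro g hg
    obtain ⟨r, hr, rfl⟩ := (h g).1 hg
    have : ∑ i, r i • rankOne form (p i) = ∑ i, r i • (R i - R 0) := by
      simp only [smul_sub, Finset.sum_sub_distrib, ← Finset.sum_smul, hr, zero_smul, sub_zero, R]
    rw [this]
    refine U.sum_mem fun i _ => U.smul_mem _ ?_
    rcases eq_or_ne i 0 with rfl | hi
    · rw [sub_self]
      exact U.zero_mem
    · exact hall i 0 hi
  have := Submodule.finrank_mono hle
  omega

lemma EquitantSpan.not_containsConfocalLine (hform : IsHermitianPPM form)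
    (hp : GeneralPosition p) (h : EquitantSpan form p W) : ¬ ContainsConfocalLine W := by
  rintro ⟨U, hU, hUD, x, hx, hUx⟩
  have hform0 : ∀ k l, k ≠ l → form x (p k) = 0 → form x (p l) = 0 →
      ∀ m, m ≠ k → m ≠ l → form x (p m) ≠ 0 := by
    intro k l hkl hk hl m hmk hml hm
    obtain ⟨n, hn⟩ : ∃ n, ∀ i, i ≠ n → i = k ∨ i = l ∨ i = m := by
      clear hk hl hm
      revert k l m
      decide
    refine hx (hp.eq_zero_of_orthogonal hform n fun i hi => ?_)
    rcases hn i hi with rfl | rfl | rfl <;> assumption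
  -- A member of W killing x is determined by its n-th coefficient, so such members form a space of
  -- dimension at most 1. The index n is taken with ⟨x, p_n⟩ = 0 if possible: at most one further
  -- p_m is orthogonal to x, and its coefficient vanishes because the sum does.
  have key : ∃ n, ∀ r : Fin 4 → ℝ, ∑ i, r i = 0 → (∑ i, r i • rankOne form (p i)) x = 0 →
      r n = 0 → ∑ i, r i • rankOne form (p i) = 0 := by
    have hzero : ∀ (r : Fin 4 → ℝ) n, (∑ i, r i • rankOne form (p i)) x = 0 → r n = 0 →
        ∀ i, form x (p i) ≠ 0 → r i = 0 := by
      intro r n hr hn i hi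
      have hsum : ∑ i, ((r i : ℂ) * form x (p i)) • p i = 0 := by
        simpa [LinearMap.sum_apply, mul_smul] using hr
      have := hp.coeff_eq_zero (n := n) (by simp [hn]) hsum i
      simpa [hi] using this
    by_cases hex : ∃ n, form x (p n) = 0
    · obtain ⟨n, hn⟩ := hex
      refine ⟨n, fun r hr hrx hrn => Finset.sum_eq_zero fun m _ => ?_⟩
      suffices r m = 0 by rw [this, zero_smul]
      rcases eq_or_ne m n with rfl | hmn
      · exact hrn
      by_contra hrm
      refine hrm ?_
      rw [← hr]
      refine (Finset.sum_eq_single_of_mem m (Finset.mem_univ _) fun i _ him => ?_).symm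
      rcases eq_or_ne i n with rfl | hin
      · exact hrn
      have hm : form x (p m) = 0 := by
        by_contra hm
        exact hrm (hzero r n hrx hrn m hm)
      exact hzero r n hrx hrn i (hform0 m n hmn hm hn i him hin)
    · push Not at hex
      exact ⟨0, fun r _ hrx hr0 => Finset.sum_eq_zero fun i _ => by
        rw [hzero r 0 hrx hr0 i (hex i), zero_smul]⟩
  obtain ⟨n, hn⟩ := key
  have hfin : Module.Finite ℝ U := Module.finite_of_finrank_pos (by rw [hU]; norm_num)
  let b := Module.finBasisOfFinrankEq ℝ U hU
  obtain ⟨r, hr, hrb⟩ := (h _).1 (hUD (b 0).2).1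
  obtain ⟨s, hs, hsb⟩ := (h _).1 (hUD (b 1).2).1
  -- This combination of the basis of U has n-th coefficient zero.
  have hcomb : s n • (b 0 : V →ₗ[ℂ] V) + (-r n) • (b 1 : V →ₗ[ℂ] V) = 0 := by
    have heq : s n • (b 0 : V →ₗ[ℂ] V) + (-r n) • (b 1 : V →ₗ[ℂ] V) =
        ∑ i, (s n * r i - r n * s i) • rankOne form (p i) := by
      rw [hrb, hsb, Finset.smul_sum, Finset.smul_sum, ← Finset.sum_add_distrib]
      exact Finset.sum_congr rfl fun i _ => by module
    rw [heq]
    refine hn _ ?_ ?_ (by ring)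
    · rw [Finset.sum_sub_distrib, ← Finset.mul_sum, ← Finset.mul_sum, hr, hs]
      ring
    · rw [← heq]
      exact hUx _ (U.add_mem (U.smul_mem _ (b 0).2) (U.smul_mem _ (b 1).2))
  have hrn : -r n = 0 := Fintype.linearIndependent_iff.1 b.linearIndependent ![s n, -r n]
    (Subtype.ext (by simpa [Fin.sum_univ_two] using hcomb)) 1
  refine b.ne_zero 0 (Subtype.ext ?_)
  rw [hrb]
  exact hn r hr (by rw [← hrb]; exact hUx _ (b 0).2) (neg_eq_zero.1 hrn)

lemma EquitantSpan.exists_of_mem_span (h : EquitantSpan form p W) {g : V →ₗ[ℂ] V}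
    (hg : g ∈ Submodule.span ℂ (W : Set (V →ₗ[ℂ] V))) :
    ∃ r : Fin 4 → ℂ, ∑ i, r i = 0 ∧ g = ∑ i, r i • rankOne form (p i) := by
  induction hg using Submodule.span_induction with
  | mem g hg =>
    obtain ⟨r, hr, rfl⟩ := (h g).1 hg
    exact ⟨fun i => (r i : ℂ), by simp only [← Complex.ofReal_sum, hr, Complex.ofReal_zero],
      by simp⟩
  | zero => exact ⟨0, by simp, by simp⟩
  | add f g _ _ hf hg =>
    obtain ⟨r, hr, rfl⟩ := hf
    obtain ⟨s, hs, rfl⟩ := hg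
    exact ⟨r + s, by simp [Finset.sum_add_distrib, hr, hs],
      by simp [add_smul, Finset.sum_add_distrib]⟩
  | smul c g _ hg =>
    obtain ⟨r, hr, rfl⟩ := hg
    exact ⟨c • r, by simp [← Finset.mul_sum, hr], by simp [Finset.smul_sum, smul_smul]⟩

lemma EquitantSpan.exists_collinear_foci (hform : IsHermitianPPM form) (hp : GeneralPosition p)
    (h : EquitantSpan form p W) :
    ∃ (h : Fin 3 → (V →ₗ[ℂ] V)) (L : Submodule ℂ V),
      (∀ i, h i ∈ degenerate W ∧ h i ≠ 0) ∧
      (∀ i j, i ≠ j → ∀ t : ℝ, h i ≠ t • h j) ∧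
      Module.finrank ℂ L = 2 ∧
      (∀ i, LinearMap.ker (h i) ≤ L) ∧
      ∃ v ∈ L, v ≠ 0 ∧ v ∉ focalCubic W := by
  have hfin := hform.finite
  have horth : ∀ i j, i ≠ j → ∃ x, form x (p i) = 0 ∧ form x (p j) = 0 ∧
      ∀ k, k ≠ i → k ≠ j → form x (p k) ≠ 0 := by
    intro i j hij
    obtain ⟨x, hx, hi, hj⟩ := hform.exists_orthogonal_pair (p i) (p j)
    refine ⟨x, hi, hj, fun k hki hkj hk => hx ?_⟩
    obtain ⟨n, hn⟩ : ∃ n, ∀ m, m ≠ n → m = i ∨ m = j ∨ m = k := by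
      clear hi hj hk
      revert i j k
      decide
    refine hp.eq_zero_of_orthogonal hform n fun m hm => ?_
    rcases hn m hm with rfl | rfl | rfl <;> assumption
  refine ⟨fun i => rankOne form (p 0) - rankOne form (p i.succ),
    LinearMap.ker (form.flip (p 0)), fun i => ⟨h.sub_mem_degenerate hform _ _, fun h0 => ?_⟩,
    fun i j hij t ht => ?_, ?_, fun i x hx => ?_, ?_⟩
  · exact (Fin.succ_ne_zero i).symm (hp.rankOne_injective hform (sub_eq_zero.1 h0))
  · refine one_ne_zero (α := ℝ) <| hp.eq_zero_of_smul_sub_eq hform (i := i.succ) (j := 0) (k := 0)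
      (l := j.succ) (s := 1) (t := -t) (Fin.succ_ne_zero i) (Fin.succ_ne_zero i)
      (by simpa using hij) ?_
    rw [neg_smul, ← ht]
    simp
  · obtain ⟨x, -, -, hx⟩ := horth 1 2 (by decide)
    have := Module.Dual.finrank_ker_add_one_of_ne_zero (f := form.flip (p 0)) fun h0 =>
      hx 0 (by decide) (by decide) (by rw [← LinearMap.flip_apply, h0, LinearMap.zero_apply])
    rw [hform.finrank_eq] at this
    omega
  -- A spare index n, where the relation between `p 0` and `p i.succ` has coefficient zero.
  · obtain ⟨n, hn0, hni⟩ : ∃ n, n ≠ 0 ∧ n ≠ i.succ := by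
      clear hx
      revert i
      decide
    have hx' : form x (p 0) • p 0 - form x (p i.succ) • p i.succ = 0 := hx
    have := hp.coeff_eq_zero
      (a := Pi.single 0 (form x (p 0)) - Pi.single i.succ (form x (p i.succ))) (n := n)
      (by simp [hn0, hni])
      (by rw [← hx']; simp [sub_smul, Finset.sum_sub_distrib, Pi.single_apply]) 0
    simpa [(Fin.succ_ne_zero i).symm] using this
  · obtain ⟨a, ha0, ha1, ha⟩ := horth 0 1 (by decide)
    obtain ⟨b, hb0, hb2, hb⟩ := horth 0 2 (by decide)
    have hb1 := hb 1 (by decide) (by decide)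
    have hb3 := hb 3 (by decide) (by decide)
    have ha2 := ha 2 (by decide) (by decide)
    have ha3 := ha 3 (by decide) (by decide)
    -- The factor makes both summands pair equally with `p 3`, giving 2⟨a, p_3⟩ ≠ 0; only one
    -- summand pairs nontrivially with each of `p 1` and `p 2`.
    have hne : ∀ i, i ≠ 0 → form (a + (form a (p 3) / form b (p 3)) • b) (p i) ≠ 0 := by
      intro i hi
      rw [map_add, LinearMap.add_apply, map_smul form, LinearMap.smul_apply, smul_eq_mul]
      fin_cases i
      · exact absurd rfl hi
      · simpa [ha1] using ⟨⟨ha3, hb3⟩, hb1⟩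
      · simpa [hb2] using ha2
      · simp only [Fin.reduceFinMk]
        rw [div_mul_cancel₀ _ hb3, ← two_mul]
        exact mul_ne_zero two_ne_zero ha3
    have h0 : form (a + (form a (p 3) / form b (p 3)) • b) (p 0) = 0 := by simp [ha0, hb0]
    refine ⟨_, h0, ?_, ?_⟩
    · intro hv
      refine hne 1 (by decide) ?_
      rw [hv, map_zero, LinearMap.zero_apply]
    · rintro ⟨-, g, hg, hg0, -, hgv⟩
      obtain ⟨r, hr, rfl⟩ := h.exists_of_mem_span hg
      refine hg0 (Finset.sum_eq_zero fun i _ => ?_)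
      suffices r i = 0 by rw [this, zero_smul]
      have hri : ∀ i, i ≠ 0 → r i = 0 := by
        intro i hi
        rw [LinearMap.sum_apply] at hgv
        simp only [LinearMap.smul_apply, rankOne_apply, smul_smul] at hgv
        have := hp.coeff_eq_zero (n := 0) (by rw [h0, mul_zero]) hgv i
        exact (mul_eq_zero.1 this).resolve_right (hne i hi)
      rcases eq_or_ne i 0 with rfl | hi
      · rw [← hr]
        exact (Finset.sum_eq_single_of_mem 0 (Finset.mem_univ _) fun i _ hi => hri i hi).symm
      · exact hri i hi

lemma IsElliptic.isReal_of_isEquitant (hform : IsHermitianPPM form) (hW : IsElliptic form W)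
    (h : IsEquitant form W) : IsReal form W := by
  obtain ⟨-, p, -, -, hp, -, h⟩ := h
  exact { hW with
    no_confocal_line := EquitantSpan.not_containsConfocalLine hform hp h
    not_line_plus_point := EquitantSpan.not_isLinePlusPoint hform hp h hW.finrank_eq
    exists_collinear_foci := EquitantSpan.exists_collinear_foci hform hp h }

/-! ### Degenerate maps decomposed from the pole of a line through the focus -/

lemma generalPosition_of_forall {P : Fin 4 → V}
    (h : ∀ a : Fin 4 → ℂ, ∀ n, a n = 0 → ∑ i, a i • P i = 0 → a = 0) : GeneralPosition P := by
  intro e he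
  refine Fintype.linearIndependent_iff.2 fun g hg i => ?_
  obtain ⟨n, hn⟩ : ∃ n, n ∉ Set.range e := by
    by_contra! hall
    have := Fintype.card_le_of_surjective e hall
    simp at this
  have ha : ∀ m, m ∉ Set.range e → Function.extend e g 0 m = 0 := fun m hm => by
    rw [Function.extend_apply' _ _ _ (by simpa using hm), Pi.zero_apply]
  have := h (Function.extend e g 0) n (ha n hn) <| by
    rw [← hg]
    refine (Fintype.sum_of_injective e he _ _ (fun m hm => ?_) fun i => ?_).symm
    · rw [ha m hm, zero_smul]
    · rw [he.extend_apply, Function.comp_apply]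
  rw [← he.extend_apply g 0 i, this, Pi.zero_apply]

lemma IsHermitianPPM.linearMap_ext (hform : IsHermitianPPM form) {e : Fin 3 → V}
    (he : LinearIndependent ℂ e) {g g' : V →ₗ[ℂ] V}
    (h : ∀ i j, form (g (e i)) (e j) = form (g' (e i)) (e j)) : g = g' := by
  have := hform.finite
  refine (basisOfLinearIndependentOfCardEqFinrank he (by simp [hform.finrank_eq])).ext fun i => ?_
  rw [coe_basisOfLinearIndependentOfCardEqFinrank]
  refine sub_eq_zero.1 (hform.eq_zero_of_basis he fun j => ?_)
  rw [map_sub, LinearMap.sub_apply, h, sub_self]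

lemma linearIndependent_of_kernel {g : V →ₗ[ℂ] V} {f v p z : V} (hf : f ≠ 0) (hgf : g f = 0)
    (hgv : g v ≠ 0) (hvp : form v p = 0) (hfp : form f p = 0) (hzp : form z p = 1) :
    LinearIndependent ℂ ![v, f, z] := by
  refine Fintype.linearIndependent_iff.2 fun a ha => ?_
  simp only [Fin.sum_univ_three, Matrix.cons_val] at ha
  have h2 : a 2 = 0 := by
    simpa [hvp, hfp, hzp] using congrArg (fun x => form x p) ha
  rw [h2, zero_smul, add_zero] at ha
  have h0 : a 0 = 0 := by simpa [hgf, hgv] using congrArg g ha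
  have h1 : a 1 = 0 := by simpa [h0, hf] using ha
  intro i
  fin_cases i
  exacts [h0, h1, h2]

lemma IsHermitianPPM.exists_form_eq_one (hform : IsHermitianPPM form) {p : V} (hp : p ≠ 0) :
    ∃ z, form z p = 1 := by
  obtain ⟨y, hy⟩ : ∃ y, form p y ≠ 0 := by
    by_contra! h
    exact hp (hform.eq_zero_of_forall h)
  have hy' : form y p ≠ 0 := fun h => hy (hform.form_eq_zero_symm h)
  exact ⟨(form y p)⁻¹ • y, by simp [hy']⟩

/-- A degenerate self-adjoint map is a combination of two rank one maps, one of which is given by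
a pole `p` of a line through the focus. -/
lemma exists_eq_rankOne_add (hform : IsHermitianPPM form) {g : V →ₗ[ℂ] V}
    (hg : ∀ x y, form (g x) y = form x (g y)) {f v p : V} (hf : f ≠ 0) (hgf : g f = 0)
    (hp : p ≠ 0) (hvp : form v p = 0) (hfp : form f p = 0) (hgv : form (g v) v ≠ 0) :
    ∃ s t : ℝ, t ≠ 0 ∧ g = s • rankOne form p + t • rankOne form (g v) := by
  obtain ⟨z, hzp⟩ := hform.exists_form_eq_one hp
  have hgv0 : g v ≠ 0 := by
    intro h
    rw [h, map_zero, LinearMap.zero_apply] at hgv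
    exact hgv rfl
  have hpv := hform.form_eq_zero_symm hvp
  have hpf := hform.form_eq_zero_symm hfp
  have hpz : form p z = 1 := by rw [← hform.conj_form, hzp, map_one]
  have hreal : ∀ x, ((form (g x) x).re : ℂ) = form (g x) x := fun x =>
    Complex.conj_eq_iff_re.1 (by rw [hform.conj_form, hg])
  have hvf : form (g v) f = 0 := by rw [hg, hgf, map_zero]
  have hfv : form f (g v) = 0 := by rw [← hg, hgf, map_zero, LinearMap.zero_apply]
  have hzf : form (g z) f = 0 := by rw [hg, hgf, map_zero]
  -- Completing the square: t is the inverse of ⟨gv, v⟩ and s is the Schur complement in the basis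
  -- v, f, z.
  refine ⟨(form (g z) z).re - ‖form (g v) z‖ ^ 2 / (form (g v) v).re, ((form (g v) v).re)⁻¹, ?_, ?_⟩
  · refine inv_ne_zero fun h => hgv ?_
    rw [← hreal, h, Complex.ofReal_zero]
  refine hform.linearMap_ext (linearIndependent_of_kernel hf hgf hgv0 hvp hfp hzp) fun i j => ?_
  simp only [← Complex.coe_smul, LinearMap.add_apply, LinearMap.smul_apply, rankOne_apply, map_add,
    map_smul form, smul_eq_mul, Complex.ofReal_inv, Complex.ofReal_sub,
    Complex.ofReal_div, Complex.ofReal_pow, hreal, ← Complex.mul_conj', hform.conj_form]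
  fin_cases i <;> fin_cases j <;>
    simp [hvp, hfp, hzp, hpv, hpf, hpz, hvf, hfv, hzf, hgf, ← hg v, ← hg z, hgv]
  · field_simp
  · ring

/-- The case ⟨gv, v⟩ = 0, where the square cannot be completed and g is a hyperbolic pairing of p
with another vector. -/
lemma exists_eq_hyperbolic (hform : IsHermitianPPM form) {g : V →ₗ[ℂ] V}
    (hg : ∀ x y, form (g x) y = form x (g y)) {f v p : V} (hf : f ≠ 0) (hgf : g f = 0)
    (hp : p ≠ 0) (hvp : form v p = 0) (hfp : form f p = 0) (hgv0 : g v ≠ 0)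
    (hgv : form (g v) v = 0) :
    ∃ w, ∀ x, g x = form x w • p + form x p • w := by
  obtain ⟨z, hzp⟩ := hform.exists_form_eq_one hp
  have hpv := hform.form_eq_zero_symm hvp
  have hpf := hform.form_eq_zero_symm hfp
  have hpz : form p z = 1 := by rw [← hform.conj_form, hzp, map_one]
  have hvf : form (g v) f = 0 := by rw [hg, hgf, map_zero]
  have hfz : form f (g z) = 0 := by rw [← hg, hgf, map_zero, LinearMap.zero_apply]
  have hzf : form (g z) f = 0 := by rw [hg, hgf, map_zero]
  have hconj : conj (form (g z) z) = form (g z) z := by rw [hform.conj_form, hg]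
  -- Both terms of the formula contribute to ⟨gz, z⟩; the half avoids counting it twice.
  refine ⟨g z - (form (g z) z / 2) • p, fun x => ?_⟩
  suffices g = (form.flip (g z - (form (g z) z / 2) • p)).smulRight p +
      (form.flip p).smulRight (g z - (form (g z) z / 2) • p) from congrArg (fun f => f x) this
  refine hform.linearMap_ext (linearIndependent_of_kernel hf hgf hgv0 hvp hfp hzp) fun i j => ?_
  simp only [LinearMap.add_apply, LinearMap.smulRight_apply, LinearMap.flip_apply, map_add, map_sub,
    LinearMap.sub_apply, map_smulₛₗ, LinearMap.smul_apply, smul_eq_mul, map_div₀, hconj, map_ofNat]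
  fin_cases i <;> fin_cases j <;>
    simp [hvp, hfp, hzp, hpv, hpf, hpz, hvf, hfz, hzf, hgf, ← hg, hgv]
  ring

/-- With st ≥ 0, the base condition s|⟨q, a⟩|² + t|⟨q, b⟩|² = 0 makes b, and a when s ≠ 0,
orthogonal to the negative q, hence positive; this contradicts s⟨a, a⟩ + t⟨b, b⟩ = 0. -/
lemma IsFamily.coeff_mul_neg (hform : IsHermitianPPM form) (hW : IsFamily form W) {s t : ℝ}
    {a b : V} (ha : a ≠ 0) (hb : b ≠ 0) (ht : t ≠ 0)
    (h : s • rankOne form a + t • rankOne form b ∈ W) : s * t < 0 := by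
  obtain ⟨q, hqneg, hq⟩ := hW.base_meets_ball
  have h1 := hW.form_self_eq hform h
  have h2 := norm_form_sq_eq hform hq h
  by_contra! hst
  have hb0 : form q b = 0 := by
    have : t ^ 2 * ‖form q b‖ ^ 2 ≤ 0 := by
      have h3 : t ^ 2 * ‖form q b‖ ^ 2 = -(s * t * ‖form q a‖ ^ 2) := by linear_combination t * h2
      rw [h3]
      exact neg_nonpos.2 (mul_nonneg hst (sq_nonneg _))
    have : ‖form q b‖ ^ 2 = 0 :=
      le_antisymm (nonpos_of_mul_nonpos_right this (by positivity)) (sq_nonneg _)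
    simpa using this
  have hbpos := hform.pos_of_orthogonal_negative hqneg hb0 hb
  rcases eq_or_ne s 0 with rfl | hs
  · simp [ht, hbpos.ne'] at h1
  have ha0 : form q a = 0 := by simpa [hb0, hs] using h2
  have hapos := hform.pos_of_orthogonal_negative hqneg ha0 ha
  have h3 : t ^ 2 * (form b b).re = -(s * t * (form a a).re) := by linear_combination t * h1
  have h4 : 0 < t ^ 2 * (form b b).re := by positivity
  linarith [mul_nonneg hst hapos.le]

/-- A degenerate member of a family gives a vector whose rank one map differs from that of the pole
`p` by an element of the family. -/
lemma IsFamily.exists_rankOne_sub_mem (hform : IsHermitianPPM form) (hW : IsFamily form W)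
    {g : V →ₗ[ℂ] V} (hg : g ∈ W) {f v p : V} (hf : f ≠ 0) (hgf : g f = 0)
    (hp : p ≠ 0) (hvp : form v p = 0) (hfp : form f p = 0) (hgv : form (g v) v ≠ 0) :
    ∃ u, rankOne form p - rankOne form u ∈ W ∧ form v u ≠ 0 ∧
      ∀ x, form x p = 0 → (g x = 0 ↔ form x u = 0) := by
  have hsa := hW.selfAdjoint g hg
  obtain ⟨s, t, ht, hst⟩ := exists_eq_rankOne_add hform hsa hf hgf hp hvp hfp hgv
  have hgv0 : g v ≠ 0 := by
    intro h
    rw [h, map_zero, LinearMap.zero_apply] at hgv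
    exact hgv rfl
  have hneg : s * t < 0 := hW.coeff_mul_neg hform hp hgv0 ht (hst ▸ hg)
  have hs : s ≠ 0 := by
    rintro rfl
    simp at hneg
  -- Scaling gv by √(-t/s) turns s⁻¹g into R_p - R_u.
  have hpos : 0 < -t / s := by
    have : -t / s = -(s * t) / s ^ 2 := by field_simp
    rw [this]
    exact div_pos (by linarith) (by positivity)
  have hr : √(-t / s) ≠ 0 := (Real.sqrt_pos.2 hpos).ne'
  have hrc : ((√(-t / s) : ℝ) : ℂ) ≠ 0 := by exact_mod_cast hr
  refine ⟨((√(-t / s) : ℝ) : ℂ) • g v, ?_, ?_, fun x hx => ?_⟩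
  · have : rankOne form p - rankOne form (((√(-t / s) : ℝ) : ℂ) • g v) = s⁻¹ • g := by
      rw [rankOne_smul, Complex.norm_real, Real.norm_eq_abs, sq_abs, Complex.coe_smul,
        Real.sq_sqrt hpos.le]
      conv_rhs => rw [hst]
      rw [smul_add, smul_smul, smul_smul, inv_mul_cancel₀ hs, one_smul, neg_div, neg_smul,
        sub_neg_eq_add, div_eq_inv_mul]
    rw [this]
    exact W.smul_mem _ hg
  · rw [map_smulₛₗ, Complex.conj_ofReal, ← hsa]
    exact mul_ne_zero hrc hgv
  · have hgx : g x = (t : ℂ) • form x (g v) • g v := by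
      conv_lhs => rw [hst]
      simp [hx]
    rw [hgx, map_smulₛₗ, Complex.conj_ofReal, smul_eq_mul, mul_eq_zero]
    simp [ht, hgv0, hrc]

lemma linearIndependent_triple {p a b f g : V} (hp : p ≠ 0) (hpf : form p f = 0)
    (hpg : form p g = 0) (haf : form a f = 0) (hag : form a g ≠ 0) (hbg : form b g = 0)
    (hbf : form b f ≠ 0) : LinearIndependent ℂ ![p, a, b] := by
  refine Fintype.linearIndependent_iff.2 fun c hc => ?_
  simp only [Fin.sum_univ_three, Matrix.cons_val] at hc
  have h2 : c 2 = 0 := by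
    simpa [hpf, haf, hbf] using congrArg (fun x => form x f) hc
  have h1 : c 1 = 0 := by
    simpa [hpg, hag, hbg] using congrArg (fun x => form x g) hc
  have h0 : c 0 = 0 := by simpa [h1, h2, hp] using hc
  intro i
  fin_cases i
  exacts [h0, h1, h2]

/-- Three degenerate members of the family give three vectors which, with the pole of the line of
their foci, are in general position. -/
lemma generalPosition_of_foci {p v : V} {f u : Fin 3 → V} (hform : IsHermitianPPM form)
    (hv : ∀ g ∈ Submodule.span ℂ (W : Set (V →ₗ[ℂ] V)), g v = 0 → g = 0)
    (hp : p ≠ 0) (hvp : form v p = 0) (hfp : ∀ i, form (f i) p = 0)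
    (huW : ∀ i, rankOne form p - rankOne form (u i) ∈ W) (hvu : ∀ i, form v (u i) ≠ 0)
    (huf : ∀ i j, form (f i) (u j) = 0 ↔ i = j) :
    GeneralPosition ![p, u 0, u 1, u 2] := by
  have hpf : ∀ i, form p (f i) = 0 := fun i => hform.form_eq_zero_symm (hfp i)
  have huf' : ∀ i j, form (u j) (f i) = 0 ↔ i = j := fun i j => by
    rw [← huf]
    exact ⟨hform.form_eq_zero_symm, hform.form_eq_zero_symm⟩
  have hpair : ∀ i j, i ≠ j → ∀ a b c : ℂ, a • p + b • u i + c • u j = 0 →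
      a = 0 ∧ b = 0 ∧ c = 0 := by
    intro i j hij a b c h
    have := Fintype.linearIndependent_iff.1 (linearIndependent_triple hp (hpf i) (hpf j)
      ((huf' i i).2 rfl) (fun h => hij ((huf' j i).1 h).symm) ((huf' j j).2 rfl)
      (fun h => hij ((huf' i j).1 h))) ![a, b, c] (by simpa [Fin.sum_univ_three] using h)
    exact ⟨this 0, this 1, this 2⟩
  refine generalPosition_of_forall fun a n hn ha => ?_
  simp only [Fin.sum_univ_four, Matrix.cons_val] at ha
  suffices a 0 = 0 ∧ a 1 = 0 ∧ a 2 = 0 ∧ a 3 = 0 by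
    funext i
    fin_cases i
    exacts [this.1, this.2.1, this.2.2.1, this.2.2.2]
  fin_cases n
  · replace hn : a 0 = 0 := hn
    let g : Fin 3 → (V →ₗ[ℂ] V) := fun i => rankOne form p - rankOne form (u i)
    have hg : ∀ i, g i ∈ Submodule.span ℂ (W : Set (V →ₗ[ℂ] V)) := fun i =>
      Submodule.subset_span (huW i)
    have hgx : ∀ i x, form x p = 0 → g i x = -(form x (u i) • u i) := by
      intro i x hx
      simp [g, hx]
    -- Since g_i v = -⟨v, u_i⟩u_i, these weights turn the relation among the u_i into a member of ℂW
    -- killing v, hence zero. Its value at `f 0` involves only u_1 and u_2, which are independent.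
    have hzero := hv ((a 1 / form v (u 0)) • g 0 + (a 2 / form v (u 1)) • g 1 +
      (a 3 / form v (u 2)) • g 2)
      (add_mem (add_mem (Submodule.smul_mem _ _ (hg 0)) (Submodule.smul_mem _ _ (hg 1)))
        (Submodule.smul_mem _ _ (hg 2))) (by
          simp only [LinearMap.add_apply, LinearMap.smul_apply, hgx _ _ hvp, smul_neg, smul_smul,
            div_mul_cancel₀ _ (hvu _)]
          rw [hn, zero_smul, zero_add] at ha
          rw [← neg_add, ← neg_add, ha, neg_zero])
    have h0 := congrArg (fun g : V →ₗ[ℂ] V => g (f 0)) hzero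
    simp only [LinearMap.add_apply, LinearMap.smul_apply, hgx _ _ (hfp 0), smul_neg, smul_smul,
      (huf 0 0).2 rfl, zero_smul, neg_zero, smul_zero, zero_add, LinearMap.zero_apply] at h0
    obtain ⟨-, h1, h2⟩ := hpair 1 2 (by decide) 0
      (a 2 / form v (u 1) * form (f 0) (u 1)) (a 3 / form v (u 2) * form (f 0) (u 2))
      (by rw [zero_smul, zero_add, ← neg_eq_zero, neg_add, h0])
    have h01 : form (f 0) (u 1) ≠ 0 := fun h => by simpa using (huf 0 1).1 h
    have h02 : form (f 0) (u 2) ≠ 0 := fun h => by simpa using (huf 0 2).1 h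
    have ha2 : a 2 = 0 := by simpa [h01, hvu] using h1
    have ha3 : a 3 = 0 := by simpa [h02, hvu] using h2
    rw [hn, ha2, ha3, zero_smul, zero_smul, zero_smul, zero_add, add_zero, add_zero] at ha
    refine ⟨hn, (smul_eq_zero.1 ha).resolve_right fun hu => hvu 0 ?_, ha2, ha3⟩
    rw [hu, map_zero]
  · replace hn : a 1 = 0 := hn
    obtain ⟨h0, h2, h3⟩ := hpair 1 2 (by decide) (a 0) (a 2) (a 3) (by simpa [hn] using ha)
    exact ⟨h0, hn, h2, h3⟩
  · replace hn : a 2 = 0 := hn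
    obtain ⟨h0, h2, h3⟩ := hpair 0 2 (by decide) (a 0) (a 1) (a 3) (by simpa [hn] using ha)
    exact ⟨h0, h2, hn, h3⟩
  · replace hn : a 3 = 0 := hn
    obtain ⟨h0, h2, h3⟩ := hpair 0 1 (by decide) (a 0) (a 1) (a 2) (by simpa [hn] using ha)
    exact ⟨h0, h2, h3, hn⟩

/-! ### The case of a hyperbolic member -/

lemma generalPosition_quadruple {p a b : V} (hli : LinearIndependent ℂ ![p, a, b])
    {x y m n s t : ℂ} (hx : x ≠ 0) (hy : y ≠ 0) (hxy : x ≠ y) (hmn : m ^ 2 ≠ n ^ 2)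
    (h1 : t * n ≠ s * m) (h2 : t * m ≠ s * n) :
    GeneralPosition ![x • p + s • a + t • b, y • p + s • a + t • b, m • a + n • b,
      n • a + m • b] := by
  refine generalPosition_of_forall fun c i hi hc => ?_
  have := Fintype.linearIndependent_iff.1 hli
    ![c 0 * x + c 1 * y, (c 0 + c 1) * s + c 2 * m + c 3 * n, (c 0 + c 1) * t + c 2 * n + c 3 * m]
    (by
      rw [← hc]
      simp only [Fin.sum_univ_three, Fin.sum_univ_four, Matrix.cons_val]
      module)
  have e0 : c 0 * x + c 1 * y = 0 := this 0
  have e1 : (c 0 + c 1) * s + c 2 * m + c 3 * n = 0 := this 1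
  have e2 : (c 0 + c 1) * t + c 2 * n + c 3 * m = 0 := this 2
  clear this hc
  rw [← sub_ne_zero] at hxy hmn h1 h2
  suffices c 0 = 0 ∧ c 1 = 0 ∧ c 2 = 0 ∧ c 3 = 0 by
    funext i
    fin_cases i
    exacts [this.1, this.2.1, this.2.2.1, this.2.2.2]
  have last : c 0 = 0 → c 1 = 0 → c 0 = 0 ∧ c 1 = 0 ∧ c 2 = 0 ∧ c 3 = 0 := by
    intro h0 h1
    rw [h0, h1] at e1 e2
    exact ⟨h0, h1, (mul_eq_zero.1 (by linear_combination m * e1 - n * e2 :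
      c 2 * (m ^ 2 - n ^ 2) = 0)).resolve_right hmn, (mul_eq_zero.1
      (by linear_combination m * e2 - n * e1 : c 3 * (m ^ 2 - n ^ 2) = 0)).resolve_right hmn⟩
  have sum_zero : c 0 + c 1 = 0 → c 0 = 0 ∧ c 1 = 0 ∧ c 2 = 0 ∧ c 3 = 0 := by
    intro h
    have h0 : c 0 = 0 := (mul_eq_zero.1 (by linear_combination e0 - y * h :
      c 0 * (x - y) = 0)).resolve_right hxy
    exact last h0 (by linear_combination h - h0)
  fin_cases i
  · replace hi : c 0 = 0 := hi
    rw [hi, zero_mul, zero_add] at e0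
    exact last hi ((mul_eq_zero.1 e0).resolve_right hy)
  · replace hi : c 1 = 0 := hi
    rw [hi, zero_mul, add_zero] at e0
    exact last ((mul_eq_zero.1 e0).resolve_right hx) hi
  · replace hi : c 2 = 0 := hi
    rw [hi] at e1 e2
    refine sum_zero ((mul_eq_zero.1 (?_ : (c 0 + c 1) * (t * n - s * m) = 0)).resolve_right h1)
    linear_combination n * e2 - m * e1
  · replace hi : c 3 = 0 := hi
    rw [hi] at e1 e2
    refine sum_zero ((mul_eq_zero.1 (?_ : (c 0 + c 1) * (t * m - s * n) = 0)).resolve_right h2)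
    linear_combination m * e2 - n * e1

/-- The points are xp + sa + tb, yp + sa + tb, ma + nb, na + mb. The first two differ by (x - y)g
when x + y = 2 Re α. With mn = st the cross terms in a and b cancel in the other differences; xy =
s² + t² - m² - n² then balances the coefficient of R_p. -/
lemma IsElliptic.isEquitant_of_hyperbolic_pos (hform : IsHermitianPPM form)
    (hW : IsElliptic form W) {p a b w : V} {g : V →ₗ[ℂ] V}
    (hli : LinearIndependent ℂ ![p, a, b]) (hg : g ∈ W)
    (hgw : ∀ x, g x = form x w • p + form x p • w)
    (haW : rankOne form p - rankOne form a ∈ W) (hbW : rankOne form p - rankOne form b ∈ W)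
    {α : ℂ} {s t : ℝ} (hs : 0 < s) (ht : 0 < t)
    (hw : w = α • p + (s : ℂ) • a + (t : ℂ) • b) : IsEquitant form W := by
  obtain ⟨m, n, hmnst, hm, hn, hlt, h1, h2, hK⟩ : ∃ m n : ℝ, m * n = s * t ∧ 0 < m ∧ 0 < n ∧
      n < m ∧ t * n < s * m ∧ s * n < t * m ∧ s ^ 2 + t ^ 2 < m ^ 2 + n ^ 2 := by
    have hst : 0 < s + t := add_pos hs ht
    have hn : 0 < s * t / (s + t) := by positivity
    have hns : s * t / (s + t) < s := by rw [div_lt_iff₀ hst]; nlinarith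
    have hnt : s * t / (s + t) < t := by rw [div_lt_iff₀ hst]; nlinarith
    -- Any m > max(s, t) with n = st/m would do, as m² + n² - s² - t² = (m² - s²)(m² - t²)/m².
    refine ⟨s + t, s * t / (s + t), by field_simp, hst, hn, by linarith, ?_, ?_, ?_⟩
    · nlinarith
    · nlinarith
    · nlinarith [mul_pos hs ht, mul_pos hn hn]
  obtain ⟨x, y, hxy, hxy'⟩ : ∃ x y : ℝ, x + y = 2 * α.re ∧
      x * y = -(m ^ 2 + n ^ 2 - s ^ 2 - t ^ 2) := by
    have := Real.sq_sqrt (by nlinarith [sq_nonneg α.re] :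
      0 ≤ α.re ^ 2 + (m ^ 2 + n ^ 2 - s ^ 2 - t ^ 2))
    exact ⟨α.re + √(α.re ^ 2 + (m ^ 2 + n ^ 2 - s ^ 2 - t ^ 2)),
      α.re - √(α.re ^ 2 + (m ^ 2 + n ^ 2 - s ^ 2 - t ^ 2)), by ring, by linear_combination -this⟩
  have hxyneg : x * y < 0 := by rw [hxy']; linarith
  have hα : α + conj α = x + y := by
    rw [Complex.add_conj]
    exact_mod_cast hxy.symm
  have hxyc : (x : ℂ) * y = -(m ^ 2 + n ^ 2 - s ^ 2 - t ^ 2) := by exact_mod_cast hxy'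
  have hmnc : (m : ℂ) * n = s * t := by exact_mod_cast hmnst
  have hsq : n ^ 2 < m ^ 2 := by nlinarith
  refine hW.isEquitant_of_generalPosition hform (generalPosition_quadruple hli
    (x := x) (y := y) (m := m) (n := n) (s := s) (t := t) ?_ ?_ ?_ ?_ ?_ ?_) ?_
  · exact_mod_cast left_ne_zero_of_mul hxyneg.ne
  · exact_mod_cast right_ne_zero_of_mul hxyneg.ne
  · have : x ≠ y := by
      rintro rfl
      nlinarith [mul_self_nonneg x]
    exact_mod_cast this
  · exact_mod_cast hsq.ne'
  · exact_mod_cast h1.ne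
  · exact_mod_cast h2.ne'
  · have hgw' : ∀ z, g z = (conj α * form z p + s * form z a + t * form z b) • p +
        form z p • (α • p + (s : ℂ) • a + (t : ℂ) • b) := by
      intro z
      rw [hgw, hw]
      simp only [map_add, map_smulₛₗ, Complex.conj_ofReal, smul_eq_mul]
    intro i
    fin_cases i
    · convert W.smul_mem (x - y) hg using 1
      ext z
      simp only [Matrix.cons_val, Fin.succ_zero_eq_one, Fin.zero_eta, LinearMap.sub_apply,
        rankOne_apply, map_add, map_smulₛₗ,
        Complex.conj_ofReal, smul_eq_mul, LinearMap.smul_apply, hgw', ← Complex.coe_smul,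
        Complex.ofReal_sub]
      match_scalars
      · linear_combination (-(x - y) * form z p) * hα
      · ring
      · ring
    · convert W.add_mem (W.smul_mem x hg) (W.add_mem (W.smul_mem (m ^ 2 - s ^ 2) haW)
        (W.smul_mem (n ^ 2 - t ^ 2) hbW)) using 1
      ext z
      simp only [Matrix.cons_val, Fin.mk_one, Fin.reduceSucc, LinearMap.sub_apply,
        LinearMap.add_apply, rankOne_apply, map_add, map_smulₛₗ,
        Complex.conj_ofReal, smul_eq_mul, LinearMap.smul_apply, hgw', ← Complex.coe_smul,
        Complex.ofReal_sub, Complex.ofReal_pow]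
      match_scalars
      · linear_combination (-x * form z p) * hα - form z p * hxyc
      · linear_combination (-form z b) * hmnc
      · linear_combination (-form z a) * hmnc
    · convert W.add_mem (W.smul_mem x hg) (W.add_mem (W.smul_mem (n ^ 2 - s ^ 2) haW)
        (W.smul_mem (m ^ 2 - t ^ 2) hbW)) using 1
      ext z
      simp only [Matrix.cons_val, Fin.reduceFinMk, Fin.reduceSucc, LinearMap.sub_apply,
        LinearMap.add_apply, rankOne_apply, map_add, map_smulₛₗ,
        Complex.conj_ofReal, smul_eq_mul, LinearMap.smul_apply, hgw', ← Complex.coe_smul,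
        Complex.ofReal_sub, Complex.ofReal_pow]
      match_scalars
      · linear_combination (-x * form z p) * hα - form z p * hxyc
      · linear_combination (-form z b) * hmnc
      · linear_combination (-form z a) * hmnc

lemma rankOne_smul_of_norm_eq_one {c : ℂ} (hc : ‖c‖ = 1) (p : V) :
    rankOne form (c • p) = rankOne form p := by
  rw [rankOne_smul, hc]
  simp

/-- Phases of a and b do not affect their rank one maps, so β and γ may be made positive. -/
lemma IsElliptic.isEquitant_of_hyperbolic (hform : IsHermitianPPM form)
    (hW : IsElliptic form W) {p a b w : V} {g : V →ₗ[ℂ] V}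
    (hli : LinearIndependent ℂ ![p, a, b]) (hg : g ∈ W)
    (hgw : ∀ x, g x = form x w • p + form x p • w)
    (haW : rankOne form p - rankOne form a ∈ W) (hbW : rankOne form p - rankOne form b ∈ W)
    {α β γ : ℂ} (hβ : β ≠ 0) (hγ : γ ≠ 0)
    (hw : w = α • p + β • a + γ • b) : IsEquitant form W := by
  have hnorm : ∀ {c : ℂ}, c ≠ 0 → ‖c / ‖c‖‖ = 1 := fun hc => by simp [hc]
  have hmul : ∀ {c : ℂ}, c ≠ 0 → (‖c‖ : ℂ) * (c / ‖c‖) = c := fun hc =>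
    mul_div_cancel₀ _ (by simpa using hc)
  have hunit : ∀ {c : ℂ}, c ≠ 0 → c / ‖c‖ ≠ 0 := fun hc => div_ne_zero hc (by simpa using hc)
  refine hW.isEquitant_of_hyperbolic_pos hform (p := p) (a := (β / ‖β‖) • a) (b := (γ / ‖γ‖) • b)
    (α := α) (s := ‖β‖) (t := ‖γ‖) ?_ hg hgw ?_ ?_ (norm_pos_iff.2 hβ) (norm_pos_iff.2 hγ) ?_
  · convert hli.units_smul ![1, Units.mk0 _ (hunit hβ), Units.mk0 _ (hunit hγ)] using 1
    funext i
    fin_cases i <;> simp [Units.smul_def]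
  · rwa [rankOne_smul_of_norm_eq_one (hnorm hβ)]
  · rwa [rankOne_smul_of_norm_eq_one (hnorm hγ)]
  · rw [smul_smul, smul_smul, hmul hβ, hmul hγ, hw]

/-! ### Real families are equitant -/

/-- Otherwise g and g' would span a confocal line. Thus distinct points of the curve have distinct
foci. -/
lemma IsGeneric.apply_ne_zero (hform : IsHermitianPPM form) (hW : IsGeneric form W)
    {g g' : V →ₗ[ℂ] V} (hg : g ∈ W) (hg' : g' ∈ W) (hg0 : g ≠ 0)
    (hne : ∀ t : ℝ, g' ≠ t • g) {f : V} (hf : f ≠ 0) (hgf : g f = 0) : g' f ≠ 0 := by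
  intro hgf'
  refine hW.no_confocal_line ⟨Submodule.span ℝ (Set.range ![g, g']), ?_, ?_⟩
  · have : LinearIndependent ℝ ![g, g'] :=
      (LinearIndependent.pair_iff' hg0).2 fun t h => hne t h.symm
    rw [finrank_span_eq_card this, Fintype.card_fin]
  have hle : Submodule.span ℝ (Set.range ![g, g']) ≤ W := by
    rw [Submodule.span_le]
    rintro _ ⟨i, rfl⟩
    fin_cases i
    exacts [hg, hg']
  have hker : ∀ h ∈ Submodule.span ℝ (Set.range ![g, g']), h f = 0 := by
    intro h hh
    rw [Submodule.mem_span_range_iff_exists_fun] at hh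
    obtain ⟨c, rfl⟩ := hh
    simp [Fin.sum_univ_two, hgf, hgf']
  exact ⟨fun h hh => ⟨hle hh, det_eq_zero_of_apply_eq_zero hform hf (hker h hh)⟩, f, hf, hker⟩

lemma IsReal.isEquitant (hform : IsHermitianPPM form) (hW : IsReal form W) :
    IsEquitant form W := by
  have hfin := hform.finite
  obtain ⟨h, L, hD, hne, hL, hker, v, hvL, hv0, hvE⟩ := hW.exists_collinear_foci
  have hv : ∀ g ∈ Submodule.span ℂ (W : Set (V →ₗ[ℂ] V)), g v = 0 → g = 0 := by
    intro g hg hgv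
    by_contra hg0
    exact hvE ⟨hv0, g, hg, hg0, det_eq_zero_of_apply_eq_zero hform hv0 hgv, hgv⟩
  have hhW : ∀ i, h i ∈ W := fun i => (hD i).1.1
  have hhv : ∀ i, h i v ≠ 0 := fun i hi =>
    (hD i).2 (hv _ (Submodule.subset_span (hhW i)) hi)
  have hf : ∀ i, ∃ f, f ≠ 0 ∧ h i f = 0 := by
    intro i
    obtain ⟨f, hf, hf0⟩ :=
      (Submodule.ne_bot_iff _).1 (LinearMap.det_eq_zero_iff_ker_ne_bot.1 (hD i).1.2)
    exact ⟨f, hf0, hf⟩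
  choose f hf0 hhf using hf
  have hhf' : ∀ i j, h j (f i) = 0 ↔ i = j := by
    refine fun i j => ⟨fun hij => ?_, fun hij => hij ▸ hhf i⟩
    by_contra hne'
    exact hW.toIsGeneric.apply_ne_zero hform (hhW i) (hhW j) (hD i).2 (hne j i (Ne.symm hne'))
      (hf0 i) (hhf i) hij
  obtain ⟨p, hp, hpv, hpf⟩ := hform.exists_orthogonal_pair v (f 0)
  have hvp := hform.form_eq_zero_symm hpv
  have hLp : ∀ x ∈ L, form x p = 0 := by
    have hli : LinearIndependent ℂ ![v, f 0] := by
      refine LinearIndependent.pair_iff.2 fun a b hab => ?_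
      have ha : a = 0 := by simpa [hhf, hhv] using congrArg (h 0) hab
      exact ⟨ha, by simpa [ha, hf0] using hab⟩
    have hspan : Submodule.span ℂ (Set.range ![v, f 0]) = L := by
      refine Submodule.eq_of_le_of_finrank_eq (Submodule.span_le.2 ?_) ?_
      · rintro _ ⟨i, rfl⟩
        fin_cases i
        exacts [hvL, hker 0 (hhf 0)]
      · rw [finrank_span_eq_card hli, hL, Fintype.card_fin]
    intro x hx
    rw [← hspan, Submodule.mem_span_range_iff_exists_fun] at hx
    obtain ⟨c, rfl⟩ := hx
    simp [Fin.sum_univ_two, hvp, hform.form_eq_zero_symm hpf]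
  have hfp : ∀ i, form (f i) p = 0 := fun i => hLp _ (hker i (hhf i))
  have hpoint : ∀ i, form (h i v) v ≠ 0 → ∃ u, rankOne form p - rankOne form u ∈ W ∧
      form v u ≠ 0 ∧ ∀ j, form (f j) u = 0 ↔ j = i := by
    intro i hi
    obtain ⟨u, hu, hvu, hxu⟩ := hW.toIsFamily.exists_rankOne_sub_mem hform (hhW i) (hf0 i) (hhf i)
      hp hvp (hfp i) hi
    exact ⟨u, hu, hvu, fun j => by rw [← hxu _ (hfp j), hhf']⟩
  by_cases hall : ∀ i, form (h i v) v ≠ 0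
  · choose u hu hvu hfu using fun i => hpoint i (hall i)
    refine hW.toIsElliptic.isEquitant_of_generalPosition hform
      (generalPosition_of_foci hform hv hp hvp hfp hu hvu fun i j => hfu j i) fun i => ?_
    fin_cases i
    exacts [hu 0, hu 1, hu 2]
  push Not at hall
  obtain ⟨k, hk⟩ := hall
  obtain ⟨w, hw⟩ := exists_eq_hyperbolic hform (hW.selfAdjoint _ (hhW k)) (hf0 k) (hhf k) hp hvp
    (hfp k) (hhv k) hk
  -- Two hyperbolic members both send v into ℂp, so a combination of them kills v and is zero;
  -- evaluation at `f k` contradicts the distinctness of the foci.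
  have hother : ∀ i, i ≠ k → form (h i v) v ≠ 0 := by
    intro i hik hi
    obtain ⟨w', hw'⟩ := exists_eq_hyperbolic hform (hW.selfAdjoint _ (hhW i)) (hf0 i) (hhf i) hp hvp
      (hfp i) (hhv i) hi
    have hvw : form v w ≠ 0 := fun h => hhv k (by rw [hw, hvp, h, zero_smul, zero_smul, add_zero])
    have hcomb := hv (form v w • h i - form v w' • h k)
      (sub_mem (Submodule.smul_mem _ _ (Submodule.subset_span (hhW i)))
        (Submodule.smul_mem _ _ (Submodule.subset_span (hhW k)))) (by
          rw [LinearMap.sub_apply, LinearMap.smul_apply, LinearMap.smul_apply, hw, hw', hvp]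
          module)
    have := congrArg (fun g : V →ₗ[ℂ] V => g (f k)) hcomb
    simp only [LinearMap.sub_apply, LinearMap.smul_apply, hhf, smul_zero, sub_zero,
      LinearMap.zero_apply, smul_eq_zero, hvw, false_or, hhf'] at this
    exact hik this.symm
  obtain ⟨i, j, hik, hjk, hij⟩ : ∃ i j, i ≠ k ∧ j ≠ k ∧ i ≠ j := by
    clear hk hw hother
    revert k
    decide
  obtain ⟨a, ha, -, hfa⟩ := hpoint i (hother i hik)
  obtain ⟨b, hb, -, hfb⟩ := hpoint j (hother j hjk)
  have hsymm : ∀ x y, form y x = 0 ↔ form x y = 0 := fun x y =>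
    ⟨hform.form_eq_zero_symm, hform.form_eq_zero_symm⟩
  have hpf' : ∀ i, form p (f i) = 0 := fun i => hform.form_eq_zero_symm (hfp i)
  have hli : LinearIndependent ℂ ![p, a, b] := by
    refine linearIndependent_triple (f := f i) (g := f j) hp (hpf' i) (hpf' j) ?_ ?_ ?_ ?_
    · rw [hsymm, hfa]
    · rw [Ne, hsymm, hfa]
      exact hij.symm
    · rw [hsymm, hfb]
    · rw [Ne, hsymm, hfb]
      exact hij
  -- Here h_k f_m = ⟨f_m, w⟩p. As f_j is orthogonal to p and b, and f_i to p and a, this makes the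
  -- coefficients of w at a and b nonzero.
  have hwf : ∀ m, m ≠ k → form w (f m) ≠ 0 := by
    intro m hm h0
    refine hm ((hhf' m k).1 ?_)
    rw [hw, hfp, hform.form_eq_zero_symm h0, zero_smul, zero_smul, add_zero]
  obtain ⟨c, hc⟩ : ∃ c : Fin 3 → ℂ, ∑ i, c i • ![p, a, b] i = w := by
    rw [← Submodule.mem_span_range_iff_exists_fun,
      hli.span_eq_top_of_card_eq_finrank' (by rw [hform.finrank_eq, Fintype.card_fin])]
    exact Submodule.mem_top
  simp only [Fin.sum_univ_three, Matrix.cons_val] at hc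
  refine hW.toIsElliptic.isEquitant_of_hyperbolic hform hli (hhW k) hw ha hb (α := c 0) (β := c 1)
    (γ := c 2) (fun h1 => hwf j hjk ?_) (fun h2 => hwf i hik ?_) hc.symm
  · rw [← hc, h1, zero_smul, add_zero, map_add, map_smul form, map_smul form, LinearMap.add_apply,
      LinearMap.smul_apply, LinearMap.smul_apply, hpf', (hsymm (f j) b).2 ((hfb j).2 rfl), smul_zero,
      smul_zero, add_zero]
  · rw [← hc, h2, zero_smul, add_zero, map_add, map_smul form, map_smul form, LinearMap.add_apply,
      LinearMap.smul_apply, LinearMap.smul_apply, hpf', (hsymm (f i) a).2 ((hfa i).2 rfl), smul_zero,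
      smul_zero, add_zero]

end BisectorFamily

theorem proposition1p2p9 {V : Type*} [AddCommGroup V] [Module ℂ V]
    (form : V →ₗ[ℂ] V →ₗ⋆[ℂ] ℂ) (hform : BisectorFamily.IsHermitianPPM form)
    (W : Submodule ℝ (V →ₗ[ℂ] V)) (hW : BisectorFamily.IsElliptic form W) :
    BisectorFamily.IsEquitant form W ↔ BisectorFamily.IsReal form W :=
  ⟨hW.isReal_of_isEquitant hform, fun h => h.isEquitant hform⟩
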